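/- All spaces are Tychonoff (completely regular and Hausdorff). Let $X$ be a pseudocompact space, i.e. every continuous function $X\to\mathbb{R}$ is bounded, and let $\beta X$ be its Stone–Čech compactification. Then the following assertions are equivalent: (i) $X$ is a $CZ$-space, i.e. every countable union of zero-sets of $X$ is also a countable intersection of cozero-sets of $X$; (ii) $\beta X$ is scattered; (iii) $\beta X$ is functionally countable; (iv) $X$ is functionally countable. Here a zero-set of $X$ is a set of the form $f^{-1}(0)$ with $f:X\to\mathbb{R}$ continuous, and a cozero-set is the complement of a zero-set; a space is scattered if every nonempty subspace of it has an isolated point; and a space is functionally countable if every second countable (Tychonoff) space that is a continuous image of it is countable. -/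

import Mathlib

namespace CZSpaces

universe u

/-- A zero-set of `X`: a set of the form `f ⁻¹(0)` with `f : X → ℝ` continuous. -/
def IsZeroSet {X : Type u} [TopologicalSpace X] (A : Set X) : Prop :=
  ∃ f : C(X, ℝ), A = f ⁻¹' {0}

/-- A cozero-set: the complement of a zero-set. -/
def IsCozeroSet {X : Type u} [TopologicalSpace X] (B : Set X) : Prop :=
  ∃ A : Set X, IsZeroSet A ∧ B = Aᶜ

/-- A countable union of zero-sets. As `∅` is a zero-set, sequences cover finite families too. -/
def IsZerSigma {X : Type u} [TopologicalSpace X] (S : Set X) : Prop :=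
  ∃ A : ℕ → Set X, (∀ n, IsZeroSet (A n)) ∧ S = ⋃ n, A n

/-- A countable intersection of cozero-sets. As `X` is a cozero-set, sequences cover finite
families too. -/
def IsCozDelta {X : Type u} [TopologicalSpace X] (S : Set X) : Prop :=
  ∃ B : ℕ → Set X, (∀ n, IsCozeroSet (B n)) ∧ S = ⋂ n, B n

/-- A `CZ`-space: every countable union of zero-sets is a countable intersection of
cozero-sets. -/
def IsCZSpace (X : Type u) [TopologicalSpace X] : Prop :=
  ∀ S : Set X, IsZerSigma S → IsCozDelta S

/-- A space is pseudocompact if every continuous real-valued function on it is bounded. -/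
def IsPseudocompact (X : Type u) [TopologicalSpace X] : Prop :=
  ∀ f : C(X, ℝ), ∃ M : ℝ, ∀ x : X, |f x| ≤ M

/-- A space is scattered if every nonempty subspace has an isolated point. -/
def IsScattered (X : Type u) [TopologicalSpace X] : Prop :=
  ∀ S : Set X, S.Nonempty → ∃ x : S, IsOpen ({x} : Set S)

/-- A space is functionally countable if each of its second countable (Tychonoff) continuous
images is countable. Every image of `X` has a copy in the universe of `X`, so it suffices to
quantify over that universe. -/
def IsFunctionallyCountable (X : Type u) [TopologicalSpace X] : Prop :=
  ∀ (Y : Type u) [TopologicalSpace Y] [T35Space Y] [SecondCountableTopology Y] (f : X → Y),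
    Continuous f → Function.Surjective f → Countable Y

end CZSpaces

namespace CZSpaces

open Set Topology TopologicalSpace

universe u v

section

variable {X : Type u} [TopologicalSpace X]

/-! Pseudocompactness makes images of zero-sets in metrizable spaces closed, so second countable
images are compact. If such an image of a CZ-space were uncountable, it would contain a nonempty
perfect set P. The preimage of a countable dense subset of P is a union of countably many zero-sets;
covering its complement by countably many zero-sets and taking images contradicts Baire in P.
Conversely, one map to a countable power of `ℝ` codes countably many zero-sets. For compact spaces,
scatteredness is linked to countable images by a minimal closed preimage in one direction and a
Cantor tree in the other. -/

lemma isZeroSet_preimage_singleton {Y : Type v} [TopologicalSpace Y] [MetrizableSpace Y]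
    {f : X → Y} (hf : Continuous f) (y : Y) : IsZeroSet (f ⁻¹' {y}) := by
  let := metrizableSpaceMetric Y
  refine ⟨⟨fun x => dist (f x) y, by fun_prop⟩, ?_⟩
  ext x
  simp

/-- On a pseudocompact space, continuous maps to metrizable spaces send zero-sets to closed
sets. -/
lemma IsPseudocompact.isClosed_image (hX : IsPseudocompact X) {Y : Type v} [TopologicalSpace Y]
    [MetrizableSpace Y] {f : X → Y} (hf : Continuous f) {Z : Set X} (hZ : IsZeroSet Z) :
    IsClosed (f '' Z) := by
  let := metrizableSpaceMetric Y
  obtain ⟨g, rfl⟩ := hZ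
  refine isClosed_of_closure_subset fun y hy => ?_
  by_contra hyZ
  have hpos : ∀ x, 0 < dist (f x) y + |g x| := by
    intro x
    by_contra hx
    have h1 : dist (f x) y = 0 := by linarith [dist_nonneg (x := f x) (y := y), abs_nonneg (g x)]
    have h2 : |g x| = 0 := by linarith [dist_nonneg (x := f x) (y := y), abs_nonneg (g x)]
    exact hyZ ⟨x, by simpa using h2, by simpa using h1⟩
  -- Points of the zero-set mapping close to `y` make this reciprocal unbounded.
  obtain ⟨M, hM⟩ := hX ⟨fun x => (dist (f x) y + |g x|)⁻¹,
    Continuous.inv₀ (by fun_prop) fun x => (hpos x).ne'⟩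
  obtain ⟨_, ⟨x, hx, rfl⟩, hxy⟩ := Metric.mem_closure_iff.1 hy (|M| + 1)⁻¹ (by positivity)
  have hgx : g x = 0 := by simpa using hx
  have h := (le_abs_self _).trans ((hM x).trans (le_abs_self M))
  have hd : 0 < dist (f x) y := by simpa [hgx] using hpos x
  simp only [ContinuousMap.coe_mk, hgx, abs_zero, add_zero] at h
  rw [dist_comm] at hxy
  have := (lt_inv_comm₀ hd (by positivity)).1 hxy
  linarith

lemma isZeroSet_univ : IsZeroSet (univ : Set X) := ⟨0, by ext; simp⟩

lemma isCozeroSet_univ : IsCozeroSet (univ : Set X) :=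
  ⟨∅, ⟨1, by ext; simp⟩, by simp⟩

lemma IsPseudocompact.isClosed_range (hX : IsPseudocompact X) {Y : Type v} [TopologicalSpace Y]
    [MetrizableSpace Y] {f : X → Y} (hf : Continuous f) : IsClosed (range f) :=
  image_univ (f := f) ▸ hX.isClosed_image hf isZeroSet_univ

/-- A second countable continuous image of a pseudocompact space is compact. -/
lemma IsPseudocompact.compactSpace (hX : IsPseudocompact X) {Y : Type v} [TopologicalSpace Y]
    [T3Space Y] [SecondCountableTopology Y] {f : X → Y} (hf : Continuous f)
    (hs : Function.Surjective f) : CompactSpace Y := by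
  let := metrizableSpaceMetric Y
  obtain ⟨e, he⟩ := Metric.PiNatEmbed.exists_embedding_to_hilbert_cube (X := Y)
  have h := hX.isClosed_range (he.continuous.comp hf)
  rw [hs.range_comp] at h
  exact IsClosedEmbedding.compactSpace ⟨he, h⟩

lemma IsFunctionallyCountable.countable_range (hX : IsFunctionallyCountable X) {Y : Type v}
    [TopologicalSpace Y] [T35Space Y] [SecondCountableTopology Y] {f : X → Y}
    (hf : Continuous f) : (range f).Countable := by
  -- The quotient of `X` by the kernel of `f` is a copy of the image in the universe of `X`.
  let r := Setoid.ker f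
  let k : Quotient r ≃ range f := Setoid.quotientKerEquivRange f
  let t : TopologicalSpace (Quotient r) := .induced k inferInstance
  have hk : IsEmbedding k := ⟨⟨rfl⟩, k.injective⟩
  have := hk.t35Space
  have := hk.secondCountableTopology
  have hc : Continuous (Quotient.mk r) := by
    rw [hk.continuous_iff]
    exact hf.subtype_mk _
  have := hX (Quotient r) (Quotient.mk r) hc Quotient.mk_surjective
  exact k.symm.injective.countable

/-- The complement of the union consists of countably many fibres of the map coding all the `A n`,
and each fibre is a zero-set. -/
theorem IsFunctionallyCountable.isCZSpace (hX : IsFunctionallyCountable X) : IsCZSpace X := by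
  rintro S ⟨A, hA, rfl⟩
  choose a ha using hA
  let F : X → ℕ → ℝ := fun x n => a n x
  have hF : Continuous F := by fun_prop
  have hc : (range F ∩ {y | ∀ n, y n ≠ 0}).Countable :=
    (hX.countable_range hF).mono inter_subset_left
  have key : ∀ x, x ∈ ⋃ n, A n ↔ F x ∉ range F ∩ {y | ∀ n, y n ≠ 0} := by
    intro x
    simp [ha, F]
  rcases (range F ∩ {y | ∀ n, y n ≠ 0}).eq_empty_or_nonempty with h | h
  · refine ⟨fun _ => univ, fun _ => isCozeroSet_univ, ?_⟩
    ext x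
    rw [key, h]
    simp
  · obtain ⟨u, hu⟩ := hc.exists_eq_range h
    refine ⟨fun n => (F ⁻¹' {u n})ᶜ, fun n => ⟨_, isZeroSet_preimage_singleton hF _, rfl⟩, ?_⟩
    ext x
    rw [key, hu]
    simp [eq_comm]

/-- A nonempty perfect set in a compact Hausdorff space is not the union of a countable dense
subset and countably many closed sets missing it. -/
lemma not_subset_iUnion_of_perfect {Y : Type v} [TopologicalSpace Y] [CompactSpace Y] [T2Space Y]
    {P : Set Y} (hP : Perfect P) (hne : P.Nonempty) {D : Set P} (hD : Dense D)
    (hDc : D.Countable) {C : ℕ → Set Y} (hC : ∀ n, IsClosed (C n))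
    (hdis : ∀ n, ∀ d ∈ D, (d : Y) ∉ C n) : ∃ y ∈ P, (∀ d ∈ D, (d : Y) ≠ y) ∧ ∀ n, y ∉ C n := by
  by_contra! hcov
  have := isCompact_iff_compactSpace.1 hP.closed.isCompact
  have := hne.to_subtype
  have := hDc.to_subtype
  let f : ℕ ⊕ D → Set P := Sum.elim (fun n => Subtype.val ⁻¹' C n) fun d => {(d : P)}
  have hclosed : ∀ i, IsClosed (f i) := by
    rintro (n | d)
    · exact (hC n).preimage continuous_subtype_val
    · exact isClosed_singleton
  have hunion : ⋃ i, f i = univ := by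
    refine eq_univ_of_forall fun y => mem_iUnion.2 ?_
    by_cases hy : y ∈ D
    · exact ⟨.inr ⟨y, hy⟩, rfl⟩
    · obtain ⟨n, hn⟩ := hcov y y.2 fun d hd h => hy (Subtype.ext h ▸ hd)
      exact ⟨.inl n, hn⟩
  -- Baire: no `C n` has interior in `P`, since `D` is dense; no singleton does, since `P` is
  -- perfect.
  obtain ⟨i, hi⟩ := nonempty_interior_of_iUnion_of_closed hclosed hunion
  rcases i with n | d
  · simp only [f, Sum.elim_inl] at hi
    obtain ⟨d, hd, hdD⟩ := hD.inter_open_nonempty _ isOpen_interior hi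
    exact hdis n d hdD (interior_subset (s := Subtype.val ⁻¹' C n) hd)
  · simp only [f, Sum.elim_inr] at hi
    obtain ⟨x, hx⟩ := hi
    obtain rfl : x = d := interior_subset (s := {(d : P)}) hx
    obtain ⟨U, hU, hUx⟩ := isOpen_induced_iff.1 (isOpen_interior (s := ({(d : P)} : Set P)))
    obtain ⟨y, ⟨hyU, hyP⟩, hyx⟩ := preperfect_iff_nhds.1 hP.acc d d.1.2 U
      (hU.mem_nhds (by rw [← hUx] at hx; exact hx))
    have : (⟨y, hyP⟩ : P) ∈ Subtype.val ⁻¹' U := hyU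
    rw [hUx] at this
    exact hyx (congrArg Subtype.val (interior_subset (s := {(d : P)}) this))

theorem IsCZSpace.isFunctionallyCountable (h : IsCZSpace X) (hX : IsPseudocompact X) :
    IsFunctionallyCountable X := by
  intro Y _ _ _ f hf hs
  have := hX.compactSpace hf hs
  by_contra hY
  obtain ⟨P, hP, hne, -⟩ := exists_perfect_nonempty_of_isClosed_of_not_countable
    (isClosed_univ (X := Y)) (by rwa [countable_univ_iff])
  obtain ⟨D, hDc, hD⟩ := exists_countable_dense P
  have := hne.to_subtype
  obtain ⟨u, rfl⟩ := hDc.exists_eq_range hD.nonempty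
  obtain ⟨B, hB, hS⟩ := h (⋃ n, f ⁻¹' {(u n : Y)})
    ⟨_, fun n => isZeroSet_preimage_singleton hf _, rfl⟩
  choose Z hZ hBZ using hB
  have hmem : ∀ x, (∃ n, f x = u n) ↔ ∀ n, x ∉ Z n := by
    intro x
    have := congrArg (x ∈ ·) hS
    simpa [hBZ] using this
  obtain ⟨y, -, hyD, hyC⟩ := not_subset_iUnion_of_perfect hP hne hD hDc
    (fun n => hX.isClosed_image hf (hZ n)) (by
      rintro n _ ⟨m, rfl⟩ ⟨x, hx, hxm⟩
      exact (hmem x).1 ⟨m, hxm⟩ n hx)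
  obtain ⟨x, rfl⟩ := hs y
  obtain ⟨n, hn⟩ := (hmem x).2 fun n hx => hyC n ⟨x, hx, rfl⟩
  exact hyD _ ⟨n, rfl⟩ hn.symm

theorem IsScattered.isFunctionallyCountable [CompactSpace X] (h : IsScattered X) :
    IsFunctionallyCountable X := by
  intro Y _ _ _ f hf hs
  by_contra hY
  obtain ⟨P, hP, ⟨p, hp⟩, -⟩ := exists_perfect_nonempty_of_isClosed_of_not_countable
    (isClosed_univ (X := Y)) (by rwa [countable_univ_iff])
  have := isCompact_iff_compactSpace.1 (hP.closed.preimage hf).isCompact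
  -- `E` is a minimal closed set mapping onto `P`. Deleting an isolated point of `E` loses exactly
  -- one value, which would then be isolated in `P`.
  obtain ⟨E, _, hE, hmin⟩ := exists_compact_surjective_zorn_subset
    (X := P.restrictPreimage f) (hf.restrictPreimage) (P.restrictPreimage_surjective hs)
  obtain ⟨e, he, -⟩ := hE.ge (mem_univ (⟨p, hp⟩ : P))
  obtain ⟨⟨_, x, hxE, rfl⟩, hx⟩ := h (Subtype.val '' E) ⟨e, e, he, rfl⟩
  obtain ⟨U, hU, hUx⟩ := isOpen_induced_iff.1 hx
  have hUE : ∀ z ∈ E, (z : X) ∈ U ↔ z = x := by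
    intro z hz
    have := congrArg ((⟨z, z, hz, rfl⟩ : Subtype.val '' E) ∈ ·) hUx
    simpa [Subtype.ext_iff] using this
  let E₀ : Set E := {z | (z : X) ∉ U}
  have hE₀ : IsClosed E₀ :=
    hU.isClosed_compl.preimage (continuous_subtype_val.comp continuous_subtype_val)
  have hne : E₀ ≠ univ := fun h0 =>
    (h0.ge (mem_univ (⟨x, hxE⟩ : E)) : (x : X) ∉ U) ((hUE x hxE).2 rfl)
  have hcov : ∀ y : P, y ≠ P.restrictPreimage f x →
      y ∈ E.domRestrict (P.restrictPreimage f) '' E₀ := by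
    intro y hy
    obtain ⟨z, hz, rfl⟩ := hE.ge (mem_univ y)
    exact ⟨⟨z, hz⟩, fun hzU => hy (by rw [(hUE z hz).1 hzU]), rfl⟩
  have hx₀ : P.restrictPreimage f x ∉ E.domRestrict (P.restrictPreimage f) '' E₀ := by
    intro hx₀
    refine hmin E₀ hne hE₀ (eq_univ_of_forall fun y => ?_)
    by_cases hy : y = P.restrictPreimage f x
    · exact hy ▸ hx₀
    · exact hcov y hy
  have hcl : IsClosed (E.domRestrict (P.restrictPreimage f) '' E₀) :=
    (hE₀.isCompact.image ((hf.restrictPreimage).comp continuous_subtype_val)).isClosed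
  obtain ⟨V, hV, hVE⟩ := isOpen_induced_iff.1 hcl.isOpen_compl
  have hVx : P.restrictPreimage f x ∈ (Subtype.val ⁻¹' V : Set P) := hVE.ge hx₀
  obtain ⟨y, ⟨hyV, hyP⟩, hyx⟩ := preperfect_iff_nhds.1 hP.acc _
    (P.restrictPreimage f x).2 V (hV.mem_nhds hVx)
  exact hVE.le (show (⟨y, hyP⟩ : P) ∈ Subtype.val ⁻¹' V from hyV)
    (hcov _ fun h => hyx (congrArg Subtype.val h))

/-- A compact Hausdorff space with a nonempty perfect subset has a continuous map to a countable
power of `ℝ` with uncountable range. -/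
lemma exists_continuous_not_countable_range [CompactSpace X] [T2Space X] {P : Set X}
    (hP : Perfect P) (hne : P.Nonempty) :
    ∃ F : X → List Bool → ℝ, Continuous F ∧ ¬ (range F).Countable := by
  let T := {C : Set X // Perfect C ∧ C.Nonempty}
  have hsplit : ∀ C : T, ∃ c : Bool → T, (∀ b, (c b).1 ⊆ C.1) ∧
      Disjoint (c false).1 (c true).1 := by
    rintro ⟨C, hC, hCne⟩
    obtain ⟨C₀, C₁, ⟨h₀, h₀', h₀''⟩, ⟨h₁, h₁', h₁''⟩, hd⟩ := hC.splitting hCne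
    exact ⟨fun b => bif b then ⟨C₁, h₁, h₁'⟩ else ⟨C₀, h₀, h₀'⟩,
      by rintro (_ | _) <;> assumption, hd⟩
  choose c hc hcd using hsplit
  have hsep : ∀ C : T, ∃ f : C(X, ℝ), EqOn f 0 (c C false).1 ∧ EqOn f 1 (c C true).1 := by
    intro C
    obtain ⟨f, h0, h1, -⟩ := exists_continuous_zero_one_of_isClosed
      (c C false).2.1.closed (c C true).2.1.closed (hcd C)
    exact ⟨f, h0, h1⟩
  choose g hg₀ hg₁ using hsep
  -- The head of the list is the latest choice, matching the order of `PiNat.res`.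
  let t : List Bool → T := fun l => l.foldr (fun b C => c C b) ⟨P, hP, hne⟩
  let F : X → List Bool → ℝ := fun x l => g (t l) x
  have hF : Continuous F := by fun_prop
  have hbranch : ∀ a : ℕ → Bool, ∃ x, ∀ n, x ∈ (t (PiNat.res a n)).1 := by
    intro a
    have := IsCompact.nonempty_iInter_of_sequence_nonempty_isCompact_isClosed
      (fun n => (t (PiNat.res a n)).1) (fun n => hc _ _) (fun n => (t _).2.2)
      (t _).2.1.closed.isCompact (fun n => (t _).2.1.closed)
    obtain ⟨x, hx⟩ := this
    exact ⟨x, mem_iInter.1 hx⟩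
  choose p hp using hbranch
  have hval : ∀ a n, F (p a) (PiNat.res a n) = bif a n then 1 else 0 := by
    intro a n
    have h : p a ∈ (c (t (PiNat.res a n)) (a n)).1 := hp a (n + 1)
    cases hb : a n <;> rw [hb] at h
    · exact hg₀ _ h
    · exact hg₁ _ h
  -- At the node where two branches split, the separating function is 0 on one and 1 on the other.
  have hinj : Function.Injective fun a => (⟨F (p a), p a, rfl⟩ : range F) := by
    intro a b hab
    have hab : F (p a) = F (p b) := congrArg Subtype.val hab
    by_contra hne
    have hres : PiNat.res a (PiNat.firstDiff a b) = PiNat.res b (PiNat.firstDiff a b) :=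
      PiNat.res_eq_res.2 fun m hm => PiNat.apply_eq_of_lt_firstDiff hm
    have ha := hval a (PiNat.firstDiff a b)
    have hb := hval b (PiNat.firstDiff a b)
    rw [hab, hres, hb] at ha
    refine PiNat.apply_firstDiff_ne hne ?_
    revert ha
    cases a (PiNat.firstDiff a b) <;> cases b (PiNat.firstDiff a b) <;> simp
  refine ⟨F, hF, fun hcount => ?_⟩
  have := hcount.to_subtype
  have := hinj.countable
  obtain ⟨s, hs⟩ := exists_surjective_nat (ℕ → Bool)
  obtain ⟨n, hn⟩ := hs fun n => !(s n n)
  simpa using congrFun hn n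

lemma exists_perfect_of_not_isScattered (h : ¬ IsScattered X) :
    ∃ P : Set X, Perfect P ∧ P.Nonempty := by
  simp only [IsScattered, not_forall, not_exists] at h
  obtain ⟨S, hne, hS⟩ := h
  refine ⟨closure S, Preperfect.perfect_closure (preperfect_iff_nhds.2 fun x hx U hU => ?_),
    hne.closure⟩
  by_contra! hcon
  obtain ⟨V, hVU, hV, hxV⟩ := mem_nhds_iff.1 hU
  refine hS ⟨x, hx⟩ (isOpen_induced_iff.2 ⟨V, hV, ?_⟩)
  ext y
  refine ⟨fun hy => Subtype.ext (hcon y ⟨hVU hy, y.2⟩), ?_⟩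
  rintro rfl
  exact hxV

theorem IsFunctionallyCountable.isScattered [CompactSpace X] [T2Space X]
    (h : IsFunctionallyCountable X) : IsScattered X := by
  by_contra hX
  obtain ⟨P, hP, hne⟩ := exists_perfect_of_not_isScattered hX
  obtain ⟨F, hF, hFc⟩ := exists_continuous_not_countable_range hP hne
  exact hFc (h.countable_range hF)

/-- Both spaces have the same second countable images: maps from `X` extend because their images are
compact, and the image of `X` under a map from `StoneCech X` is both dense and closed. -/
theorem IsPseudocompact.isFunctionallyCountable_stoneCech_iff (hX : IsPseudocompact X) :
    IsFunctionallyCountable (StoneCech X) ↔ IsFunctionallyCountable X := by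
  constructor
  · intro h Y _ _ _ f hf hs
    have := hX.compactSpace hf hs
    refine h Y (stoneCechExtend hf) (continuous_stoneCechExtend hf) fun y => ?_
    obtain ⟨x, rfl⟩ := hs y
    exact ⟨stoneCechUnit x, stoneCechExtend_stoneCechUnit hf x⟩
  · intro h Y _ _ _ f hf hs
    have hg : Continuous (f ∘ stoneCechUnit) := hf.comp continuous_stoneCechUnit
    refine h Y _ hg (range_eq_univ.1 ?_)
    rw [← (hX.isClosed_range hg).closure_eq]
    exact (hs.denseRange.comp denseRange_stoneCechUnit hf).closure_eq

end

end CZSpaces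

theorem theorem2p9 {X : Type*} [TopologicalSpace X] [T35Space X]
    (hX : CZSpaces.IsPseudocompact X) :
    List.TFAE [
      CZSpaces.IsCZSpace X,
      CZSpaces.IsScattered (StoneCech X),
      CZSpaces.IsFunctionallyCountable (StoneCech X),
      CZSpaces.IsFunctionallyCountable X] := by
  tfae_have 1 → 4 := fun h => h.isFunctionallyCountable hX
  tfae_have 4 → 1 := fun h => h.isCZSpace
  tfae_have 2 → 3 := fun h => h.isFunctionallyCountable
  tfae_have 3 → 2 := fun h => h.isScattered
  tfae_have 3 ↔ 4 := hX.isFunctionallyCountable_stoneCech_iff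
  tfae_finish
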